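/- **Theorem A.** Let $1\to A\to G\to Q\to 1$ be an extension of finite groups with $A$ abelian and $|A|=|Q|$. Let $Q$ act on $A$ by conjugation in $G$, let $[\beta]\in H^2(Q,A)$ be the class of the extension, and let $\check A=\mathrm{Hom}(A,\mathbb C^*)$ carry the diagonal action $\langle g(\chi),a\rangle=\langle\chi,g^{-1}(a)\rangle$; all groups act trivially on $\mathbb C^*$. Call a class in $H^1(Q,\check A)$ *bijective* if it is represented by a 1-cocycle $\pi:Q\to\check A$ that is a bijective map. Call a class in $H^2(G,\mathbb C^*)$ *non-degenerate* if it is represented by a 2-cocycle $c$ whose twisted group algebra $\mathbb C^c[G]$ (with basis $U_\gamma$, $\gamma\in G$, and product $U_\gamma U_\sigma=c(\gamma,\sigma)U_{\gamma\sigma}$) is isomorphic to a matrix algebra $M_n(\mathbb C)$. Let $\mathrm{res}^G_A:H^2(G,\mathbb C^*)\to H^2(A,\mathbb C^*)$ and $\mathrm{inf}^Q_G:H^2(Q,\mathbb C^*)\to H^2(G,\mathbb C^*)$ be restriction and inflation, and put $$K_\beta=\{[\pi]\in H^1(Q,\check A)\;:\;[\beta]\cup[\pi]=0\in H^3(Q,\mathbb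 C^*)\},$$ where $[\beta]\cup[\pi]$ is the cup product followed by evaluation, i.e. the class of $(g_1,g_2,g_3)\mapsto\langle\pi(g_1),g_1(\beta(g_2,g_3))\rangle$. Then there is a group isomorphism $$C:K_\beta\to\ker(\mathrm{res}^G_A)/\mathrm{im}(\mathrm{inf}^Q_G),$$ given as follows. Let $(\bar g)_{g\in Q}$ be any system of lifts of the elements of $Q$ to $G$, let $\beta$ be its factor set, $\bar g\,\bar h=\beta(g,h)\overline{gh}$, let $\pi\in Z^1(Q,\check A)$, and let $\zeta:Q\times Q\to\mathbb C^*$ be any 2-cochain with $\delta\zeta(g_1,g_2,g_3)=\langle\pi(g_1),g_1(\beta(g_2,g_3))\rangle$. Then $$c_\pi(a_1\bar g_1,a_2\bar g_2)=\langle\pi(g_1),g_1(a_2)\rangle^{-1}\,\zeta(g_1,g_2)\qquad(a_i\in A,\ g_i\in Q)$$ is a 2-cocycle on $G$ with $[c_\pi]\in\ker(\mathrm{res}^G_A)$, and $C([\pi])=[c_\pi]\bmod\mathrm{im}(\mathrm{inf}^Q_G)$. Moreover, $C$ restricts to a 1-1 correspondence between the set of bijective classes $[\pi]\in H^1(Q,\check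 A)$ with $[\beta]\cup[\pi]=0$ and the set of non-degenerate classes in $\ker(\mathrm{res}^G_A)$ taken modulo $\mathrm{im}(\mathrm{inf}^Q_G)$ (the cosets that contain a non-degenerate class). -/

import Mathlib

open CategoryTheory

noncomputable section

/-! ### Cup product `H²(G, M) × H¹(G, N) → H³(G, P)` along an equivariant pairing `N × M → P` -/

namespace CupProduct

open groupCohomology

/-- A linear map out of `M` which kills the kernel of a surjection `f : M → N`, viewed as a map
out of `N`. -/
def descend {R M N P : Type*} [Ring R] [AddCommGroup M] [AddCommGroup N] [AddCommGroup P]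
    [Module R M] [Module R N] [Module R P] (f : M →ₗ[R] N) (hf : Function.Surjective f)
    (g : M →ₗ[R] P) (h : LinearMap.ker f ≤ LinearMap.ker g) : N →ₗ[R] P :=
  ((LinearMap.ker f).liftQ g h).comp (f.quotKerEquivOfSurjective hf).symm.toLinearMap

theorem descend_apply {R M N P : Type*} [Ring R] [AddCommGroup M] [AddCommGroup N]
    [AddCommGroup P] [Module R M] [Module R N] [Module R P] (f : M →ₗ[R] N)
    (hf : Function.Surjective f) (g : M →ₗ[R] P) (h : LinearMap.ker f ≤ LinearMap.ker g) (x : M) :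
    descend f hf g h (f x) = g x := by
  have : (f.quotKerEquivOfSurjective hf).symm (f x) = (LinearMap.ker f).mkQ x := by
    rw [LinearEquiv.symm_apply_eq]; rfl
  simp only [descend, LinearMap.comp_apply, LinearEquiv.coe_coe, this]
  rfl

variable {k G : Type} [CommRing k] [Group G] {M N P : Rep.{0} k G}

/-- The 3-cochain `(g₁, g₂, g₃) ↦ ⟨p(g₁), g₁ b(g₂, g₃)⟩`. -/
def cochain (μ : N.V →ₗ[k] M.V →ₗ[k] P.V) (b : G × G → M.V) (p : G → N.V) :
    (Fin 3 → G) → P.V :=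
  fun x => μ (p (x 0)) (M.ρ (x 0) (b (x 1, x 2)))

theorem d_two_apply (f : (Fin 2 → G) → P.V) (x : Fin 3 → G) :
    inhomogeneousCochains.d P 2 f x =
      P.ρ (x 0) (f ![x 1, x 2]) - f ![x 0 * x 1, x 2] + f ![x 0, x 1 * x 2] - f ![x 0, x 1] := by
  have e0 : (fun i : Fin 2 => x i.succ) = ![x 1, x 2] := by
    funext i; fin_cases i <;> rfl
  have e1 : Fin.contractNth (0 : Fin 3) (· * ·) x = ![x 0 * x 1, x 2] := by
    funext i; fin_cases i <;> rfl
  have e2 : Fin.contractNth (1 : Fin 3) (· * ·) x = ![x 0, x 1 * x 2] := by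
    funext i; fin_cases i <;> rfl
  have e3 : Fin.contractNth (2 : Fin 3) (· * ·) x = ![x 0, x 1] := by
    funext i; fin_cases i <;> rfl
  rw [inhomogeneousCochains.d_hom_apply, Fin.sum_univ_three, e0, e1, e2, e3]
  simp [pow_succ]
  abel

theorem d_three_apply (f : (Fin 3 → G) → P.V) (x : Fin 4 → G) :
    inhomogeneousCochains.d P 3 f x =
      P.ρ (x 0) (f ![x 1, x 2, x 3]) - f ![x 0 * x 1, x 2, x 3] + f ![x 0, x 1 * x 2, x 3]
        - f ![x 0, x 1, x 2 * x 3] + f ![x 0, x 1, x 2] := by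
  have e0 : (fun i : Fin 3 => x i.succ) = ![x 1, x 2, x 3] := by
    funext i; fin_cases i <;> rfl
  have e1 : Fin.contractNth (0 : Fin 4) (· * ·) x = ![x 0 * x 1, x 2, x 3] := by
    funext i; fin_cases i <;> rfl
  have e2 : Fin.contractNth (1 : Fin 4) (· * ·) x = ![x 0, x 1 * x 2, x 3] := by
    funext i; fin_cases i <;> rfl
  have e3 : Fin.contractNth (2 : Fin 4) (· * ·) x = ![x 0, x 1, x 2 * x 3] := by
    funext i; fin_cases i <;> rfl
  have e4 : Fin.contractNth (3 : Fin 4) (· * ·) x = ![x 0, x 1, x 2] := by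
    funext i; fin_cases i <;> rfl
  rw [inhomogeneousCochains.d_hom_apply, Fin.sum_univ_four, e0, e1, e2, e3, e4]
  simp [pow_succ]
  abel

/-- A bilinear pairing of `G`-modules is equivariant. -/
def Equivariant (μ : N.V →ₗ[k] M.V →ₗ[k] P.V) : Prop :=
  ∀ g x y, μ (N.ρ g x) (M.ρ g y) = P.ρ g (μ x y)

theorem d_cochain {μ : N.V →ₗ[k] M.V →ₗ[k] P.V} (hμ : Equivariant μ)
    (b : cocycles₂ M) (p : cocycles₁ N) :
    inhomogeneousCochains.d P 3 (cochain μ b p) = 0 := by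
  funext x
  rw [d_three_apply]
  have hp := (mem_cocycles₁_iff (p : G → N.V)).1 p.2 (x 0) (x 1)
  have hb := congrArg (M.ρ (x 0)) ((mem_cocycles₂_iff (b : G × G → M.V)).1 b.2 (x 1) (x 2) (x 3))
  have hb' := congrArg (μ (p (x 0))) hb
  simp only [map_add] at hb'
  have hv := hμ (x 0) (p (x 1)) (M.ρ (x 1) (b (x 2, x 3)))
  simp only [cochain, Matrix.cons_val_zero, Matrix.cons_val_one, Matrix.cons_val, ← hv]
  rw [hp]
  simp only [map_add, LinearMap.add_apply, map_mul, Module.End.mul_apply]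
  rw [← sub_eq_zero] at hb'
  refine Eq.trans ?_ hb'
  abel

/-- The cohomology class of the cup product of two cocycles. -/
def classOfCocycles {μ : N.V →ₗ[k] M.V →ₗ[k] P.V} (hμ : Equivariant μ) :
    cocycles₂ M →ₗ[k] cocycles₁ N →ₗ[k] groupCohomology P 3 :=
  LinearMap.mk₂ k (fun b p => π P 3 (cocyclesMk (cochain μ b p) (d_cochain hμ b p)))
    (fun b b' p => by
      rw [← map_add]
      refine congrArg _ ((ModuleCat.mono_iff_injective (iCocycles P 3)).1 inferInstance ?_)
      rw [map_add, iCocycles_mk, iCocycles_mk, iCocycles_mk]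
      funext x
      simp [cochain, show (b + b') (x 1, x 2) = b (x 1, x 2) + b' (x 1, x 2) from rfl])
    (fun r b p => by
      rw [← map_smul]
      refine congrArg _ ((ModuleCat.mono_iff_injective (iCocycles P 3)).1 inferInstance ?_)
      rw [map_smul, iCocycles_mk, iCocycles_mk]
      funext x
      simp [cochain, show (r • b) (x 1, x 2) = r • b (x 1, x 2) from rfl])
    (fun b p p' => by
      rw [← map_add]
      refine congrArg _ ((ModuleCat.mono_iff_injective (iCocycles P 3)).1 inferInstance ?_)
      rw [map_add, iCocycles_mk, iCocycles_mk, iCocycles_mk]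
      funext x
      simp [cochain, show (p + p') (x 0) = p (x 0) + p' (x 0) from rfl])
    (fun r b p => by
      rw [← map_smul]
      refine congrArg _ ((ModuleCat.mono_iff_injective (iCocycles P 3)).1 inferInstance ?_)
      rw [map_smul, iCocycles_mk, iCocycles_mk]
      funext x
      simp [cochain, show (r • p) (x 0) = r • p (x 0) from rfl])

theorem π_eq_zero_of_eq_d (f : (Fin 3 → G) → P.V) (hf : inhomogeneousCochains.d P 3 f = 0)
    (h : (Fin 2 → G) → P.V) (hh : f = inhomogeneousCochains.d P 2 h) :
    π P 3 (cocyclesMk f hf) = 0 := by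
  have h1 : cocyclesMk f hf = toCocycles P 2 3 h := by
    refine (ModuleCat.mono_iff_injective (iCocycles P 3)).1 inferInstance ?_
    rw [iCocycles_mk, ← ModuleCat.comp_apply, HomologicalComplex.toCycles_i,
      inhomogeneousCochains.d_def, hh]
  rw [h1]
  exact congrArg (fun φ => φ.hom h)
    ((inhomogeneousCochains P).toCycles_comp_homologyπ 2 3)

theorem classOfCocycles_coboundary_right {μ : N.V →ₗ[k] M.V →ₗ[k] P.V} (hμ : Equivariant μ)
    (b : cocycles₂ M) (p : cocycles₁ N) (hp : (p : G → N.V) ∈ coboundaries₁ N) :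
    classOfCocycles hμ b p = 0 := by
  obtain ⟨n, hn⟩ := hp
  refine π_eq_zero_of_eq_d _ _ (fun y => μ n (b (y 0, y 1))) ?_
  funext x
  rw [d_two_apply]
  have hb := congrArg (μ n) ((mem_cocycles₂_iff (b : G × G → M.V)).1 b.2 (x 0) (x 1) (x 2))
  have hv := hμ (x 0) n (b (x 1, x 2))
  have hn' : p (x 0) = N.ρ (x 0) n - n := (congrFun hn (x 0)).symm
  simp only [map_add] at hb
  simp only [cochain, hn', map_sub, LinearMap.sub_apply, Matrix.cons_val_zero,
    Matrix.cons_val_one, hv]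
  rw [← sub_eq_zero] at hb ⊢
  rw [← hb]
  abel

theorem classOfCocycles_coboundary_left {μ : N.V →ₗ[k] M.V →ₗ[k] P.V} (hμ : Equivariant μ)
    (b : cocycles₂ M) (p : cocycles₁ N) (hb : (b : G × G → M.V) ∈ coboundaries₂ M) :
    classOfCocycles hμ b p = 0 := by
  obtain ⟨a, ha⟩ := hb
  refine π_eq_zero_of_eq_d _ _ (fun y => - μ (p (y 0)) (M.ρ (y 0) (a (y 1)))) ?_
  funext x
  rw [d_two_apply]
  have hp := (mem_cocycles₁_iff (p : G → N.V)).1 p.2 (x 0) (x 1)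
  have hv := hμ (x 0) (p (x 1)) (M.ρ (x 1) (a (x 2)))
  have ha' : b (x 1, x 2) = M.ρ (x 1) (a (x 2)) - a (x 1 * x 2) + a (x 1) :=
    (congrFun ha (x 1, x 2)).symm
  simp only [cochain, Matrix.cons_val_zero, Matrix.cons_val_one, map_neg, ← hv, ha']
  rw [hp]
  simp only [map_add, map_sub, LinearMap.add_apply, map_mul, Module.End.mul_apply]
  abel

/-- The cup product `H²(G, M) × H¹(G, N) → H³(G, P)` induced by an equivariant pairing
`N × M → P`; it sends the classes of `b` and `p` to the class of
`(g₁, g₂, g₃) ↦ ⟨p(g₁), g₁ b(g₂, g₃)⟩`. -/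
def cup {μ : N.V →ₗ[k] M.V →ₗ[k] P.V} (hμ : Equivariant μ) :
    H2 M →ₗ[k] H1 N →ₗ[k] groupCohomology P 3 :=
  descend (H2π M).hom ((ModuleCat.epi_iff_surjective (H2π M)).1 inferInstance)
    (descend (H1π N).hom ((ModuleCat.epi_iff_surjective (H1π N)).1 inferInstance)
      (classOfCocycles hμ).flip (fun p hp => LinearMap.ext fun b =>
        classOfCocycles_coboundary_right hμ b p ((H1π_eq_zero_iff p).1 hp))).flip
    (fun b hb => LinearMap.ext fun y => by
      induction y using H1_induction_on with
      | h p =>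
        refine (LinearMap.congr_fun (descend_apply (H1π N).hom _
          (classOfCocycles hμ).flip _ p) b).trans ?_
        exact classOfCocycles_coboundary_left hμ b p ((H2π_eq_zero_iff b).1 hb))

theorem cup_apply {μ : N.V →ₗ[k] M.V →ₗ[k] P.V} (hμ : Equivariant μ) (b : cocycles₂ M)
    (p : cocycles₁ N) :
    cup hμ (H2π M b) (H1π N p) = π P 3 (cocyclesMk (cochain μ b p) (d_cochain hμ b p)) := by
  refine (LinearMap.congr_fun (descend_apply (H2π M).hom _ _ _ b) (H1π N p)).trans ?_
  exact LinearMap.congr_fun (descend_apply (H1π N).hom _ (classOfCocycles hμ).flip _ p) b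

end CupProduct

/-! ### The trivial module `ℂ*`, twisted group algebras and non-degenerate classes -/

open groupCohomology

/-- `ℂ*` with the trivial action of a group `G`, written additively. -/
abbrev CStar (G : Type) [Group G] : Rep.{0} ℤ G := Rep.trivial ℤ G (Additive ℂˣ)

/-- The value at `(g, h)` of a 2-cocycle with values in `ℂ*`, as a complex number. -/
def cocycleVal {G : Type} [Group G] (c : cocycles₂ (CStar G)) (g h : G) : ℂ :=
  ((Additive.toMul (c (g, h)) : ℂˣ) : ℂ)

theorem cocycleVal_mul {G : Type} [Group G] (c : cocycles₂ (CStar G)) (g h j : G) :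
    cocycleVal c (g * h) j * cocycleVal c g h = cocycleVal c h j * cocycleVal c g (h * j) := by
  have h1 := (mem_cocycles₂_iff (c : G × G → Additive ℂˣ)).1 c.2 g h j
  exact congrArg (fun z : Additive ℂˣ => ((Additive.toMul z : ℂˣ) : ℂ)) h1

/-- The twisted group algebra `ℂ^c[G]`: the complex vector space with basis `U_g`, `g ∈ G`, and
multiplication `U_g U_h = c(g, h) U_{gh}`. -/
def TwistedGroupAlgebra {G : Type} [Group G] (_c : cocycles₂ (CStar G)) : Type := G →₀ ℂ

namespace TwistedGroupAlgebra

variable {G : Type} [Group G] (c : cocycles₂ (CStar G))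

instance : AddCommGroup (TwistedGroupAlgebra c) := inferInstanceAs (AddCommGroup (G →₀ ℂ))

instance : Module ℂ (TwistedGroupAlgebra c) := inferInstanceAs (Module ℂ (G →₀ ℂ))

/-- The basis of the twisted group algebra. -/
def U : Module.Basis G ℂ (TwistedGroupAlgebra c) := Module.Basis.ofRepr (LinearEquiv.refl ℂ (G →₀ ℂ))

/-- The multiplication of the twisted group algebra. -/
def mulMap : TwistedGroupAlgebra c →ₗ[ℂ] TwistedGroupAlgebra c →ₗ[ℂ] TwistedGroupAlgebra c :=
  (U c).constr ℂ fun g => (U c).constr ℂ fun h => cocycleVal c g h • U c (g * h)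

instance : Mul (TwistedGroupAlgebra c) := ⟨fun x y => mulMap c x y⟩

instance : One (TwistedGroupAlgebra c) := ⟨(cocycleVal c 1 1)⁻¹ • U c 1⟩

theorem mul_def (x y : TwistedGroupAlgebra c) : x * y = mulMap c x y := rfl

theorem one_def : (1 : TwistedGroupAlgebra c) = (cocycleVal c 1 1)⁻¹ • U c 1 := rfl

theorem mulMap_U (g h : G) : mulMap c (U c g) (U c h) = cocycleVal c g h • U c (g * h) := by
  simp [mulMap]

theorem U_mul_U (g h : G) : U c g * U c h = cocycleVal c g h • U c (g * h) := mulMap_U c g h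

theorem cocycleVal_ne_zero (g h : G) : cocycleVal c g h ≠ 0 := Units.ne_zero _

theorem mulMap_assoc (x y z : TwistedGroupAlgebra c) :
    mulMap c (mulMap c x y) z = mulMap c x (mulMap c y z) := by
  have h1 (g h j : G) : mulMap c (mulMap c (U c g) (U c h)) (U c j) =
      mulMap c (U c g) (mulMap c (U c h) (U c j)) := by
    simp only [mulMap_U, map_smul, LinearMap.smul_apply, smul_smul, mul_assoc]
    rw [mul_comm, cocycleVal_mul]
  have h2 (g h : G) : mulMap c (mulMap c (U c g) (U c h)) z =
      mulMap c (U c g) (mulMap c (U c h) z) :=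
    LinearMap.congr_fun (f := mulMap c (mulMap c (U c g) (U c h)))
      (g := (mulMap c (U c g)).comp (mulMap c (U c h))) ((U c).ext (h1 g h)) z
  have h3 (g : G) : mulMap c (mulMap c (U c g) y) z = mulMap c (U c g) (mulMap c y z) :=
    LinearMap.congr_fun (f := ((mulMap c).flip z).comp (mulMap c (U c g)))
      (g := (mulMap c (U c g)).comp ((mulMap c).flip z)) ((U c).ext (h2 g)) y
  exact LinearMap.congr_fun (f := ((mulMap c).flip z).comp ((mulMap c).flip y))
      (g := (mulMap c).flip (mulMap c y z)) ((U c).ext h3) x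

theorem cocycleVal_one_left (g : G) : cocycleVal c 1 g = cocycleVal c 1 1 := by
  have h := cocycleVal_mul c 1 1 g
  simp only [one_mul] at h
  exact (mul_left_cancel₀ (cocycleVal_ne_zero c 1 g) h).symm

theorem cocycleVal_one_right (g : G) : cocycleVal c g 1 = cocycleVal c 1 1 := by
  have h := cocycleVal_mul c g 1 1
  simp only [mul_one] at h
  exact mul_right_cancel₀ (cocycleVal_ne_zero c g 1) h

theorem mulMap_one_left (x : TwistedGroupAlgebra c) : mulMap c 1 x = x :=
  LinearMap.congr_fun (f := mulMap c 1) (g := LinearMap.id) ((U c).ext fun g => by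
    rw [one_def, map_smul, LinearMap.smul_apply, mulMap_U, smul_smul, cocycleVal_one_left c g,
      inv_mul_cancel₀ (cocycleVal_ne_zero c 1 1), one_smul, one_mul, LinearMap.id_apply]) x

theorem mulMap_one_right (x : TwistedGroupAlgebra c) : mulMap c x 1 = x :=
  LinearMap.congr_fun (f := (mulMap c).flip 1) (g := LinearMap.id) ((U c).ext fun g => by
    rw [LinearMap.flip_apply, one_def, map_smul, mulMap_U, smul_smul, cocycleVal_one_right c g,
      inv_mul_cancel₀ (cocycleVal_ne_zero c 1 1), one_smul, mul_one, LinearMap.id_apply]) x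

instance : Ring (TwistedGroupAlgebra c) where
  mul := (· * ·)
  one := 1
  left_distrib x y z := (mulMap c x).map_add y z
  right_distrib x y z := (mulMap c).map_add₂ x y z
  zero_mul x := (mulMap c).map_zero₂ x
  mul_zero x := (mulMap c x).map_zero
  mul_assoc := mulMap_assoc c
  one_mul := mulMap_one_left c
  mul_one := mulMap_one_right c
  neg_add_cancel := neg_add_cancel
  zsmul := (· • ·)
  nsmul := (· • ·)
  zsmul_zero' := SubNegMonoid.zsmul_zero'
  zsmul_succ' := SubNegMonoid.zsmul_succ'
  zsmul_neg' := SubNegMonoid.zsmul_neg'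
  nsmul_zero := AddMonoid.nsmul_zero
  nsmul_succ := AddMonoid.nsmul_succ
  sub_eq_add_neg := sub_eq_add_neg

instance : Algebra ℂ (TwistedGroupAlgebra c) :=
  Algebra.ofModule (fun r x y => (mulMap c).map_smul₂ r x y) (fun r x y => (mulMap c x).map_smul r y)

end TwistedGroupAlgebra

/-- A 2-cocycle `c` is non-degenerate if `ℂ^c[G]` is isomorphic to a matrix algebra `M_n(ℂ)`
(and then `n² = |G|` for finite `G`). -/
def IsNondegenerate {G : Type} [Group G] (c : cocycles₂ (CStar G)) : Prop :=
  ∃ n : ℕ, Nonempty (TwistedGroupAlgebra c ≃ₐ[ℂ] Matrix (Fin n) (Fin n) ℂ)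

/-- A class in `H²(G, ℂ*)` is non-degenerate if it is represented by a non-degenerate cocycle.
(The isomorphism type of `ℂ^c[G]` depends only on the class of `c`.) -/
def IsNondegenerateClass {G : Type} [Group G] (x : H2 (CStar G)) : Prop :=
  ∃ c : cocycles₂ (CStar G), H2π (CStar G) c = x ∧ IsNondegenerate c

/-- A class in `H¹(Q, M)` is bijective if it is represented by a bijective 1-cocycle `Q → M`. -/
def IsBijectiveClass {Q : Type} [Group Q] {M : Rep.{0} ℤ Q} (x : H1 M) : Prop :=
  ∃ p : cocycles₁ M, H1π M p = x ∧ Function.Bijective (p : Q → M.V)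

/-! ### Extensions with abelian kernel -/

/-- The group `Hom(A, ℂ*)`, written additively. -/
def DualGroup (A : Type) [CommGroup A] : Type := Additive (A →* ℂˣ)

namespace DualGroup

variable {A : Type} [CommGroup A]

instance : AddCommGroup (DualGroup A) := inferInstanceAs (AddCommGroup (Additive (A →* ℂˣ)))

/-- A homomorphism `A → ℂ*` as an element of the additive group `Hom(A, ℂ*)`. -/
def mk (χ : A →* ℂˣ) : DualGroup A := Additive.ofMul χ

/-- The homomorphism `A → ℂ*` underlying an element of `Hom(A, ℂ*)`. -/
def toHom (χ : DualGroup A) : A →* ℂˣ := Additive.toMul χ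

theorem ext {χ ψ : DualGroup A} (h : ∀ a, χ.toHom a = ψ.toHom a) : χ = ψ :=
  Additive.toMul.injective (MonoidHom.ext h)

end DualGroup

namespace GroupExtension

variable {A G Q : Type} [CommGroup A] [Group G] [Group Q] (S : GroupExtension A G Q)

theorem ker_rightHom_le_ker_conjAct : S.rightHom.ker ≤ S.conjAct.ker := by
  intro e he
  rw [← S.range_inl_eq_ker_rightHom] at he
  obtain ⟨a, rfl⟩ := he
  ext b
  apply S.inl_injective
  rw [inl_conjAct_comm, ← map_inv, ← map_mul, ← map_mul, mul_inv_cancel_comm]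
  rfl

/-- The action of `Q` on the abelian kernel `A` of an extension `1 → A → G → Q → 1`, given by
conjugation with lifts to `G`. -/
def quotAct : Q →* MulAut A :=
  S.rightHom.liftOfSurjective S.rightHom_surjective
    ⟨S.conjAct, S.ker_rightHom_le_ker_conjAct⟩

theorem quotAct_rightHom (e : G) : S.quotAct (S.rightHom e) = S.conjAct e :=
  S.rightHom.liftOfRightInverse_comp_apply _ _ _ e

theorem inl_quotAct (σ : S.Section) (g : Q) (a : A) :
    S.inl (S.quotAct g a) = σ g * S.inl a * (σ g)⁻¹ := by
  rw [← inl_conjAct_comm, ← quotAct_rightHom, Section.rightHom_section]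

/-- The action of `Q` on `A`, as a representation on the additive group `A`. -/
def kernelAction : Representation ℤ Q (Additive A) where
  toFun g := (MonoidHom.toAdditive (S.quotAct g).toMonoidHom).toIntLinearMap
  map_one' := by ext a; simp
  map_mul' g h := by ext a; simp

theorem kernelAction_apply (g : Q) (a : A) :
    S.kernelAction g (Additive.ofMul a) = Additive.ofMul (S.quotAct g a) := rfl

/-- The diagonal action of `Q` on `Hom(A, ℂ*)`: `(g χ)(a) = χ(g⁻¹ a)`. -/
def dualAction : Representation ℤ Q (DualGroup A) where
  toFun g := AddMonoidHom.toIntLinearMap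
    { toFun χ := DualGroup.mk (χ.toHom.comp (S.quotAct g⁻¹).toMonoidHom)
      map_zero' := rfl
      map_add' _ _ := rfl }
  map_one' := by
    ext χ
    apply DualGroup.ext
    intro a
    change χ.toHom (S.quotAct 1⁻¹ a) = χ.toHom a
    simp
  map_mul' g h := by
    ext χ
    apply DualGroup.ext
    intro a
    change χ.toHom (S.quotAct (g * h)⁻¹ a) = χ.toHom (S.quotAct h⁻¹ (S.quotAct g⁻¹ a))
    simp

theorem dualAction_apply (g : Q) (χ : DualGroup A) (a : A) :
    (S.dualAction g χ).toHom a = χ.toHom (S.quotAct g⁻¹ a) := rfl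

/-- The `Q`-module `A`. -/
abbrev kernelRep : Rep.{0} ℤ Q := Rep.of S.kernelAction

/-- The `Q`-module `Hom(A, ℂ*)`. -/
abbrev dualRep : Rep.{0} ℤ Q := Rep.of S.dualAction

/-- The evaluation pairing `Hom(A, ℂ*) × A → ℂ*`. -/
def pairing : S.dualRep.V →ₗ[ℤ] S.kernelRep.V →ₗ[ℤ] (CStar Q).V :=
  AddMonoidHom.toIntLinearMap
    { toFun χ := (MonoidHom.toAdditive (DualGroup.toHom χ)).toIntLinearMap
      map_zero' := rfl
      map_add' _ _ := rfl }

theorem pairing_apply (χ : DualGroup A) (a : A) :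
    S.pairing χ (Additive.ofMul a) = Additive.ofMul (χ.toHom a) := rfl

theorem pairing_equivariant : CupProduct.Equivariant S.pairing := by
  intro g χ a
  have h (a : A) : S.quotAct g⁻¹ (S.quotAct g a) = a := by
    rw [← MulAut.mul_apply, ← map_mul]
    simp
  exact congrArg (fun b : A => Additive.ofMul (DualGroup.toHom χ b)) (h (Additive.toMul a))

/-- The factor set `β` of a section `σ`: `σ(g) σ(h) = β(g, h) σ(gh)`. -/
def factorSet (σ : S.Section) (g h : Q) : A :=
  Classical.choose (MonoidHom.mem_range.1 (σ.mul_mul_mul_inv_mem_range_inl g h))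

theorem inl_factorSet (σ : S.Section) (g h : Q) :
    S.inl (S.factorSet σ g h) * σ (g * h) = σ g * σ h := by
  rw [factorSet, Classical.choose_spec (MonoidHom.mem_range.1
    (σ.mul_mul_mul_inv_mem_range_inl g h)), inv_mul_cancel_right]

/-- The factor set of a section, as a 2-cocycle of `Q` with values in `A`. -/
def factorCocycle (σ : S.Section) : cocycles₂ S.kernelRep :=
  ⟨fun g => Additive.ofMul (S.factorSet σ g.1 g.2), (mem_cocycles₂_iff _).2 fun g h j => by
    apply Additive.toMul.injective
    apply S.inl_injective
    change S.inl (S.factorSet σ (g * h) j * S.factorSet σ g h) =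
      S.inl (S.quotAct g (S.factorSet σ h j) * S.factorSet σ g (h * j))
    have h1 := S.inl_factorSet σ (g * h) j
    have h2 := S.inl_factorSet σ g h
    have h3 := S.inl_factorSet σ h j
    have h4 := S.inl_factorSet σ g (h * j)
    rw [mul_comm (S.factorSet σ (g * h) j), map_mul, map_mul, inl_quotAct _ σ]
    apply mul_right_cancel (b := σ (g * h * j))
    rw [mul_assoc, h1, ← mul_assoc, h2, mul_assoc g h j, mul_assoc _ _ (σ (g * (h * j))), h4,
      mul_assoc (σ g), ← h3]
    group⟩

/-- The class `[β] ∈ H²(Q, A)` of the extension. -/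
def extensionClass : H2 S.kernelRep := H2π S.kernelRep (S.factorCocycle S.surjInvRightHom)

theorem H2π_factorCocycle (σ : S.Section) :
    H2π S.kernelRep (S.factorCocycle σ) = S.extensionClass := by
  set τ := S.surjInvRightHom with hτ
  choose n hn using fun g => GroupExtension.Section.exists_eq_inl_mul σ τ g
  refine (H2π_eq_iff _ _).2 ⟨fun g => Additive.ofMul (n g), ?_⟩
  funext ⟨g, h⟩
  apply Additive.toMul.injective
  apply S.inl_injective
  change S.inl (S.quotAct g (n h) / n (g * h) * n g) =
    S.inl (S.factorSet σ g h / S.factorSet τ g h)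
  congr 1
  rw [eq_div_iff_mul_eq', div_mul_eq_mul_div, div_mul_eq_mul_div, div_eq_iff_eq_mul]
  apply S.inl_injective
  apply mul_right_cancel (b := τ (g * h))
  have h1 := S.inl_factorSet σ g h
  have h2 := S.inl_factorSet τ g h
  rw [hn g, hn h, hn (g * h)] at h1
  rw [map_mul _ (S.factorSet σ g h), mul_assoc (S.inl (S.factorSet σ g h)), h1,
    show S.quotAct g (n h) * n g * S.factorSet τ g h =
      n g * S.quotAct g (n h) * S.factorSet τ g h by rw [mul_comm (n g)],
    map_mul, mul_assoc _ (S.inl (S.factorSet τ g h)), h2, map_mul, inl_quotAct _ τ]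
  group

/-- The cup product with `[β]`, followed by the evaluation pairing:
`H¹(Q, Hom(A, ℂ*)) → H³(Q, ℂ*)`, `[π] ↦ [β] ∪ [π]`. -/
def cupExtensionClass : H1 S.dualRep →+ groupCohomology (CStar Q) 3 :=
  (CupProduct.cup S.pairing_equivariant S.extensionClass).toAddMonoidHom

/-- The group of classes `[π] ∈ H¹(Q, Hom(A, ℂ*))` with `[β] ∪ [π] = 0`. -/
def cupKernel : AddSubgroup (H1 S.dualRep) := S.cupExtensionClass.ker

end GroupExtension

/-- The map `H²(G, ℂ*) → H²(H, ℂ*)` induced by a group homomorphism `f : H → G`. -/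
def pullbackH2 {H G : Type} [Group H] [Group G] (f : H →* G) :
    H2 (CStar G) →+ H2 (CStar H) :=
  (groupCohomology.map (A := CStar G) (B := CStar H) f (𝟙 (CStar H)) 2).hom.toAddMonoidHom

theorem pullbackH2_apply {H G : Type} [Group H] [Group G] (f : H →* G)
    (c : cocycles₂ (CStar G)) (c' : cocycles₂ (CStar H))
    (h : ∀ x y, c' (x, y) = c (f x, f y)) :
    pullbackH2 f (H2π _ c) = H2π _ c' := by
  have h1 := congrArg (fun φ => φ.hom c)
    (H2π_comp_map (A := CStar G) (B := CStar H) f (𝟙 (CStar H)))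
  refine h1.trans (congrArg (H2π (CStar H)) ?_)
  apply cocycles₂_ext
  intro x y
  exact (h x y).symm

namespace GroupExtension

variable {A G Q : Type} [CommGroup A] [Group G] [Group Q] (S : GroupExtension A G Q)

/-- The restriction map `res : H²(G, ℂ*) → H²(A, ℂ*)`. -/
def res : H2 (CStar G) →+ H2 (CStar A) := pullbackH2 S.inl

/-- The inflation map `inf : H²(Q, ℂ*) → H²(G, ℂ*)`. -/
def inf : H2 (CStar Q) →+ H2 (CStar G) := pullbackH2 S.rightHom

/-- The quotient group `ker(res) / im(inf)`. -/
abbrev ResKerModInf : Type := S.res.ker ⧸ S.inf.range.addSubgroupOf S.res.ker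

theorem res_inf (x : H2 (CStar Q)) : S.res (S.inf x) = 0 := by
  induction x using H2_induction_on with
  | h c =>
    let c₁ := mapCocycles₂ (A := CStar Q) (B := CStar G) S.rightHom (𝟙 (CStar G)) c
    let c₂ := mapCocycles₂ (A := CStar G) (B := CStar A) S.inl (𝟙 (CStar A)) c₁
    rw [inf, res, pullbackH2_apply S.rightHom c c₁ (fun _ _ => rfl),
      pullbackH2_apply S.inl c₁ c₂ (fun _ _ => rfl), H2π_eq_zero_iff]
    refine ⟨fun _ => c (1, 1), ?_⟩
    funext ⟨a, b⟩
    have h : c₂ (a, b) = c (S.rightHom (S.inl a), S.rightHom (S.inl b)) := rfl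
    rw [rightHom_inl, rightHom_inl] at h
    rw [h]
    exact (sub_add_cancel (c (1, 1)) (c (1, 1)))

/-- The set of bijective classes `[π] ∈ H¹(Q, Hom(A, ℂ*))` with `[β] ∪ [π] = 0`. -/
def bijectiveClasses : Set S.cupKernel := {x | IsBijectiveClass (x : H1 S.dualRep)}

/-- The set of non-degenerate classes in `ker(res)`, taken modulo `im(inf)`. -/
def nondegenerateClasses : Set S.ResKerModInf :=
  {y | ∃ x : S.res.ker, IsNondegenerateClass (x : H2 (CStar G)) ∧ QuotientAddGroup.mk x = y}

end GroupExtension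

end

noncomputable section

open groupCohomology

/-! Both sides of `C` are read off from adapted cocycles (`IsAdapted`): 2-cocycles on `G` that
ignore `A` in the first variable and change by a character `π` in the second. Evaluated on a
section, such a cocycle is a cochain `ζ` with `δζ = β ∪ π`, and every such `ζ` arises this way; so
`π` admits an adapted cocycle exactly when `[β] ∪ [π] = 0` (`cocycleOfPrimitive`,
`IsAdapted.isCupPrimitive`).

Adapted classes restrict to zero on `A`, and every class restricting to zero has an adapted
representative (`exists_isAdapted_add_coboundary`). An adapted class is inflated if and only if `[π]
= 0`. Since adapted pairs add and subtract, the relation between `[π]` and `[c]` modulo inflation is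
the graph of an isomorphism (`exists_addEquiv`).

For non-degeneracy, an adapted `c` gives an algebra map from the twisted group algebra to the `Q ×
Q` matrices, in which `A` acts diagonally through the characters `π(g)`. Both algebras have
dimension `|A||Q| = |Q|²`. The map is an isomorphism precisely when the table of these characters is
invertible, that is, by independence of characters, when `π` is injective, hence bijective
(`IsAdapted.isNondegenerate_iff`). -/

/-! ### Vanishing of cohomology classes in terms of cochains -/

/-- Homology is the cokernel of the map from 2-cochains to 3-cocycles, so exactness produces the
bounding cochain. This is what extracts `ζ` from a vanishing cup product. -/
theorem CupProduct.π_eq_zero_iff {k G : Type} [CommRing k] [Group G] {P : Rep.{0} k G}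
    (f : (Fin 3 → G) → P.V) (hf : inhomogeneousCochains.d P 3 f = 0) :
    groupCohomology.π P 3 (cocyclesMk f hf) = 0 ↔
      ∃ h : (Fin 2 → G) → P.V, f = inhomogeneousCochains.d P 2 h := by
  refine ⟨fun h0 => ?_, fun ⟨h, hh⟩ => π_eq_zero_of_eq_d f hf h hh⟩
  have hex := ShortComplex.exact_of_g_is_cokernel
    (ShortComplex.mk _ _ ((inhomogeneousCochains P).toCycles_comp_homologyπ 2 3))
    ((inhomogeneousCochains P).homologyIsCokernel 2 3 (by simp))
  obtain ⟨h, hh⟩ := (ShortComplex.moduleCat_exact_iff _).1 hex (cocyclesMk f hf) h0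
  refine ⟨h, ?_⟩
  rw [← iCocycles_mk f hf, ← inhomogeneousCochains.d_def]
  refine (congrArg (iCocycles P 3) hh).symm.trans ?_
  exact congrArg (fun φ => φ.hom h) (HomologicalComplex.toCycles_i (inhomogeneousCochains P) 2 3)

/-- The value at `(x, y)` of a 2-cocycle with values in `ℂ*`, as an element of `ℂ*` written
additively. -/
def evalCocycle₂ {G : Type} [Group G] (c : cocycles₂ (CStar G)) (x y : G) : Additive ℂˣ :=
  c (x, y)

theorem cocycle_identity {G : Type} [Group G] (c : cocycles₂ (CStar G)) (x y z : G) :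
    evalCocycle₂ c (x * y) z + evalCocycle₂ c x y =
      evalCocycle₂ c y z + evalCocycle₂ c x (y * z) :=
  (mem_cocycles₂_iff (c : G × G → Additive ℂˣ)).1 c.2 x y z

/-- The 2-cocycle with values in `ℂ*` given by a function satisfying the cocycle identity. -/
def mkCocycle₂ {G : Type} [Group G] (f : G → G → Additive ℂˣ)
    (hf : ∀ x y z, f (x * y) z + f x y = f y z + f x (y * z)) : cocycles₂ (CStar G) :=
  ⟨fun x => f x.1 x.2, (mem_cocycles₂_iff _).2 hf⟩

theorem evalCocycle₂_ext {G : Type} [Group G] {c d : cocycles₂ (CStar G)}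
    (h : ∀ x y, evalCocycle₂ c x y = evalCocycle₂ d x y) : c = d :=
  cocycles₂_ext h

theorem evalCocycle₂_add {G : Type} [Group G] (c d : cocycles₂ (CStar G)) (x y : G) :
    evalCocycle₂ (c + d) x y = evalCocycle₂ c x y + evalCocycle₂ d x y := rfl

theorem evalCocycle₂_sub {G : Type} [Group G] (c d : cocycles₂ (CStar G)) (x y : G) :
    evalCocycle₂ (c - d) x y = evalCocycle₂ c x y - evalCocycle₂ d x y := rfl

theorem CStar_H2π_eq_zero_iff {G : Type} [Group G] (c : cocycles₂ (CStar G)) :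
    H2π (CStar G) c = 0 ↔
      ∃ f : G → Additive ℂˣ, ∀ x y, evalCocycle₂ c x y = f y - f (x * y) + f x := by
  rw [H2π_eq_zero_iff]
  constructor
  · rintro ⟨f, hf⟩
    exact ⟨f, fun x y => (congrFun hf (x, y)).symm⟩
  · rintro ⟨f, hf⟩
    exact ⟨f, funext fun x => (hf x.1 x.2).symm⟩

/-- The coboundary of a 1-cochain with values in `ℂ*`. -/
def coboundary {G : Type} [Group G] (f : G → Additive ℂˣ) : cocycles₂ (CStar G) :=
  mkCocycle₂ (fun x y => f y - f (x * y) + f x) fun x y z => by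
    rw [mul_assoc]
    abel

theorem coboundary_apply {G : Type} [Group G] (f : G → Additive ℂˣ) (x y : G) :
    evalCocycle₂ (coboundary f) x y = f y - f (x * y) + f x := rfl

theorem H2π_coboundary {G : Type} [Group G] (f : G → Additive ℂˣ) :
    H2π (CStar G) (coboundary f) = 0 :=
  (CStar_H2π_eq_zero_iff _).2 ⟨f, coboundary_apply f⟩

theorem H2π_sub {G : Type} [Group G] (c d : cocycles₂ (CStar G)) :
    H2π (CStar G) (c - d) = H2π (CStar G) c - H2π (CStar G) d :=
  map_sub (H2π (CStar G)).hom c d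

theorem H2π_add {G : Type} [Group G] (c d : cocycles₂ (CStar G)) :
    H2π (CStar G) (c + d) = H2π (CStar G) c + H2π (CStar G) d :=
  map_add (H2π (CStar G)).hom c d

/-- The pullback of a 2-cocycle along a group homomorphism. -/
def pullbackCocycle {H G : Type} [Group H] [Group G] (f : H →* G) (c : cocycles₂ (CStar G)) :
    cocycles₂ (CStar H) :=
  mapCocycles₂ (A := CStar G) (B := CStar H) f (𝟙 (CStar H)) c

theorem pullbackCocycle_apply {H G : Type} [Group H] [Group G] (f : H →* G)
    (c : cocycles₂ (CStar G)) (x y : H) :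
    evalCocycle₂ (pullbackCocycle f c) x y = evalCocycle₂ c (f x) (f y) := rfl

theorem pullbackH2_H2π {H G : Type} [Group H] [Group G] (f : H →* G) (c : cocycles₂ (CStar G)) :
    pullbackH2 f (H2π _ c) = H2π _ (pullbackCocycle f c) :=
  pullbackH2_apply f c _ (pullbackCocycle_apply f c)

/-! ### 1-cocycles with values in the dual of the kernel -/

namespace GroupExtension

variable {A G Q : Type} [CommGroup A] [Group G] [Group Q] {S : GroupExtension A G Q}

theorem quotAct_inv_quotAct (g : Q) (a : A) : S.quotAct g⁻¹ (S.quotAct g a) = a := by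
  rw [← MulAut.mul_apply, ← map_mul]
  simp

theorem quotAct_quotAct_inv (g : Q) (a : A) : S.quotAct g (S.quotAct g⁻¹ a) = a := by
  rw [← MulAut.mul_apply, ← map_mul]
  simp

theorem quotAct_mul (g h : Q) (a : A) : S.quotAct (g * h) a = S.quotAct g (S.quotAct h a) := by
  rw [map_mul, MulAut.mul_apply]

theorem quotAct_map_mul (g : Q) (a b : A) :
    S.quotAct g (a * b) = S.quotAct g a * S.quotAct g b := map_mul _ a b

theorem mul_inl (x : G) (a : A) :
    x * S.inl a = S.inl (S.quotAct (S.rightHom x) a) * x := by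
  rw [quotAct_rightHom, inl_conjAct_comm, inv_mul_cancel_right]

/-- The value `⟨π(g), a⟩` of a 1-cocycle `π : Q → Hom(A, ℂ*)`. -/
def evalCocycle (π : cocycles₁ S.dualRep) (g : Q) (a : A) : Additive ℂˣ :=
  Additive.ofMul ((π g).toHom a)

theorem evalCocycle_map_mul (π : cocycles₁ S.dualRep) (g : Q) (a b : A) :
    evalCocycle π g (a * b) = evalCocycle π g a + evalCocycle π g b :=
  congrArg Additive.ofMul (map_mul ((π g).toHom) a b)

/-- Evaluating at `g a` rather than `a` cancels the inverse in the diagonal action. -/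
theorem evalCocycle_mul (π : cocycles₁ S.dualRep) (g h : Q) (a : A) :
    evalCocycle π (g * h) (S.quotAct g a) =
      evalCocycle π g (S.quotAct g a) + evalCocycle π h a := by
  have h1 := (mem_cocycles₁_iff (π : Q → S.dualRep.V)).1 π.2 g h
  have h2 : evalCocycle π (g * h) (S.quotAct g a) =
      evalCocycle π h (S.quotAct g⁻¹ (S.quotAct g a)) + evalCocycle π g (S.quotAct g a) :=
    congrArg (fun z : DualGroup A => Additive.ofMul (z.toHom (S.quotAct g a))) h1
  rw [h2, quotAct_inv_quotAct, add_comm]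

theorem evalCocycle_one (π : cocycles₁ S.dualRep) (a : A) : evalCocycle π 1 a = 0 := by
  have h := evalCocycle_mul π 1 1 a
  simpa using h

theorem evalCocycle_inv (π : cocycles₁ S.dualRep) (g : Q) (a : A) :
    evalCocycle π g⁻¹ a = - evalCocycle π g (S.quotAct g a) := by
  have h := evalCocycle_mul π g g⁻¹ a
  rw [mul_inv_cancel, evalCocycle_one] at h
  exact eq_neg_of_add_eq_zero_right h.symm

theorem evalCocycle_add (π π' : cocycles₁ S.dualRep) (g : Q) (a : A) :
    evalCocycle (π + π') g a = evalCocycle π g a + evalCocycle π' g a := rfl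

theorem evalCocycle_sub (π π' : cocycles₁ S.dualRep) (g : Q) (a : A) :
    evalCocycle (π - π') g a = evalCocycle π g a - evalCocycle π' g a := by
  rw [sub_eq_add_neg, sub_eq_add_neg]
  exact congrArg Additive.ofMul (div_eq_mul_inv ((π g).toHom a) ((π' g).toHom a))

theorem H1π_dualRep_eq_zero_iff (π : cocycles₁ S.dualRep) :
    H1π S.dualRep π = 0 ↔ ∃ χ : A →* ℂˣ, ∀ g a,
      evalCocycle π g (S.quotAct g a) =
        Additive.ofMul (χ a) - Additive.ofMul (χ (S.quotAct g a)) := by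
  rw [H1π_eq_zero_iff]
  constructor
  · rintro ⟨χ, hχ⟩
    refine ⟨DualGroup.toHom χ, fun g a => ?_⟩
    have h : evalCocycle π g (S.quotAct g a) =
        Additive.ofMul (DualGroup.toHom χ (S.quotAct g⁻¹ (S.quotAct g a))) -
          Additive.ofMul (DualGroup.toHom χ (S.quotAct g a)) :=
      congrArg (fun z : DualGroup A => Additive.ofMul (z.toHom (S.quotAct g a)))
        (congrFun hχ g).symm
    rw [h, quotAct_inv_quotAct]
  · rintro ⟨χ, hχ⟩
    refine ⟨DualGroup.mk χ, funext fun g => DualGroup.ext fun a => ?_⟩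
    have h := hχ g (S.quotAct g⁻¹ a)
    rw [quotAct_quotAct_inv] at h
    exact h.symm

/-! ### Adapted cocycles and the cup product condition -/

/-- A 2-cocycle `c` on `G` is adapted to a 1-cocycle `π : Q → Hom(A, ℂ*)` if left translations
of the first variable by `A` leave `c` unchanged, and left translations of the second variable
by `A` change it by the values of `π`. -/
structure IsAdapted (π : cocycles₁ S.dualRep) (c : cocycles₂ (CStar G)) : Prop where
  left : ∀ a x y, evalCocycle₂ c (S.inl a * x) y = evalCocycle₂ c x y
  right : ∀ a x y, evalCocycle₂ c x (S.inl a * y) =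
    evalCocycle₂ c x y - evalCocycle π (S.rightHom x) (S.quotAct (S.rightHom x) a)

theorem IsAdapted.sub {π π' : cocycles₁ S.dualRep} {c c' : cocycles₂ (CStar G)}
    (h : IsAdapted π c) (h' : IsAdapted π' c') : IsAdapted (π - π') (c - c') where
  left a x y := by rw [evalCocycle₂_sub, evalCocycle₂_sub, h.left, h'.left]
  right a x y := by
    rw [evalCocycle_sub, evalCocycle₂_sub, evalCocycle₂_sub, h.right, h'.right,
      sub_sub_sub_comm]

theorem IsAdapted.add {π π' : cocycles₁ S.dualRep} {c c' : cocycles₂ (CStar G)}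
    (h : IsAdapted π c) (h' : IsAdapted π' c') : IsAdapted (π + π') (c + c') where
  left a x y := by rw [evalCocycle₂_add, evalCocycle₂_add, h.left, h'.left]
  right a x y := by
    rw [evalCocycle_add, evalCocycle₂_add, evalCocycle₂_add, h.right, h'.right,
      sub_add_sub_comm]

/-- The component in `A` of an element of `G` relative to a section. -/
def leftPart (σ : S.Section) (x : G) : A :=
  Classical.choose (show ∃ a, S.inl a = x * (σ (S.rightHom x))⁻¹ by
    rw [← MonoidHom.mem_range, S.range_inl_eq_ker_rightHom, MonoidHom.mem_ker, map_mul, map_inv,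
      Section.rightHom_section, mul_inv_cancel])

theorem inl_leftPart_mul (σ : S.Section) (x : G) :
    S.inl (leftPart σ x) * σ (S.rightHom x) = x := by
  have h : S.inl (leftPart σ x) = x * (σ (S.rightHom x))⁻¹ :=
    Classical.choose_spec (p := fun a => S.inl a = x * (σ (S.rightHom x))⁻¹) _
  rw [h, inv_mul_cancel_right]

theorem rightHom_inl_mul (a : A) (x : G) : S.rightHom (S.inl a * x) = S.rightHom x := by
  rw [map_mul, rightHom_inl, one_mul]

theorem leftPart_inl_mul (σ : S.Section) (a : A) (x : G) :
    leftPart σ (S.inl a * x) = a * leftPart σ x := by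
  apply S.inl_injective
  apply mul_right_cancel (b := σ (S.rightHom x))
  have h := inl_leftPart_mul σ (S.inl a * x)
  rw [rightHom_inl_mul] at h
  rw [h, map_mul, mul_assoc, inl_leftPart_mul]

theorem leftPart_section (σ : S.Section) (g : Q) : leftPart σ (σ g) = 1 := by
  apply S.inl_injective
  apply mul_right_cancel (b := σ g)
  have h := inl_leftPart_mul σ (σ g)
  rw [Section.rightHom_section] at h
  rw [h, map_one, one_mul]

theorem leftPart_inl_mul_section (σ : S.Section) (a : A) (g : Q) :
    leftPart σ (S.inl a * σ g) = a := by
  rw [leftPart_inl_mul, leftPart_section, mul_one]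

/-- This is the group law of `G` in the coordinates `A × Q`, twisted by the factor set. -/
theorem leftPart_mul (σ : S.Section) (x y : G) :
    leftPart σ (x * y) = leftPart σ x * S.quotAct (S.rightHom x) (leftPart σ y) *
      S.factorSet σ (S.rightHom x) (S.rightHom y) := by
  conv_lhs => rw [← inl_leftPart_mul σ x, ← inl_leftPart_mul σ y]
  rw [mul_assoc, ← mul_assoc (σ _), mul_inl, Section.rightHom_section, mul_assoc (S.inl _),
    ← inl_factorSet, leftPart_inl_mul, leftPart_inl_mul, leftPart_inl_mul, leftPart_section,
    mul_one, mul_assoc]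

/-- The condition `δζ = β ∪ π` on cochains. -/
def IsCupPrimitive (σ : S.Section) (π : cocycles₁ S.dualRep) (ζ : Q × Q → Additive ℂˣ) : Prop :=
  ∀ g₁ g₂ g₃ : Q, ζ (g₂, g₃) - ζ (g₁ * g₂, g₃) + ζ (g₁, g₂ * g₃) - ζ (g₁, g₂) =
    evalCocycle π g₁ (S.quotAct g₁ (S.factorSet σ g₂ g₃))

/-- The cocycle `(a₁ḡ₁, a₂ḡ₂) ↦ ⟨π(g₁), g₁(a₂)⟩⁻¹ ζ(g₁, g₂)`. -/
def cocycleOfPrimitive {σ : S.Section} {π : cocycles₁ S.dualRep} {ζ : Q × Q → Additive ℂˣ}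
    (h : IsCupPrimitive σ π ζ) : cocycles₂ (CStar G) :=
  mkCocycle₂ (fun x y => ζ (S.rightHom x, S.rightHom y) -
      evalCocycle π (S.rightHom x) (S.quotAct (S.rightHom x) (leftPart σ y))) fun x y z => by
    -- In coordinates all terms in `π` cancel by additivity and the 1-cocycle rule, except the one
    -- containing the factor set; `δζ` compensates it.
    have hz := h (S.rightHom x) (S.rightHom y) (S.rightHom z)
    simp only [leftPart_mul, map_mul S.rightHom, quotAct_mul, quotAct_map_mul, evalCocycle_mul,
      evalCocycle_map_mul]
    rw [← hz]
    abel

theorem cocycleOfPrimitive_apply {σ : S.Section} {π : cocycles₁ S.dualRep}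
    {ζ : Q × Q → Additive ℂˣ} (h : IsCupPrimitive σ π ζ) (x y : G) :
    evalCocycle₂ (cocycleOfPrimitive h) x y = ζ (S.rightHom x, S.rightHom y) -
      evalCocycle π (S.rightHom x) (S.quotAct (S.rightHom x) (leftPart σ y)) := rfl

theorem isAdapted_cocycleOfPrimitive {σ : S.Section} {π : cocycles₁ S.dualRep}
    {ζ : Q × Q → Additive ℂˣ} (h : IsCupPrimitive σ π ζ) :
    IsAdapted π (cocycleOfPrimitive h) where
  left a x y := by simp only [cocycleOfPrimitive_apply, rightHom_inl_mul]
  right a x y := by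
    simp only [cocycleOfPrimitive_apply, rightHom_inl_mul, leftPart_inl_mul, quotAct_map_mul,
      evalCocycle_map_mul]
    rw [add_comm, sub_add_eq_sub_sub]

/-- In the cocycle identity for three lifts, the products of lifts bring in `β` once in each
variable. The first variable ignores it; the second turns it into the value of `π`. -/
theorem IsAdapted.isCupPrimitive {π : cocycles₁ S.dualRep} {c : cocycles₂ (CStar G)}
    (h : IsAdapted π c) (σ : S.Section) :
    IsCupPrimitive σ π fun g => evalCocycle₂ c (σ g.1) (σ g.2) := by
  intro g₁ g₂ g₃
  have h1 := cocycle_identity c (σ g₁) (σ g₂) (σ g₃)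
  rw [← inl_factorSet, ← inl_factorSet, h.left, h.right, Section.rightHom_section,
    ← sub_eq_zero] at h1
  rw [← sub_eq_zero, ← neg_eq_zero, ← h1]
  abel

/-- Any section will do, because the class of the factor set does not depend on it. -/
theorem mem_cupKernel_iff (σ : S.Section) (π : cocycles₁ S.dualRep) :
    H1π S.dualRep π ∈ S.cupKernel ↔ ∃ ζ, IsCupPrimitive σ π ζ := by
  have h1 : H1π S.dualRep π ∈ S.cupKernel ↔
      CupProduct.cup S.pairing_equivariant (H2π _ (S.factorCocycle σ)) (H1π _ π) = 0 := by
    rw [S.H2π_factorCocycle]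
    exact AddMonoidHom.mem_ker
  rw [h1, CupProduct.cup_apply, CupProduct.π_eq_zero_iff]
  constructor
  · rintro ⟨h, hh⟩
    refine ⟨fun g => h ![g.1, g.2], fun g₁ g₂ g₃ => ?_⟩
    have := congrFun hh ![g₁, g₂, g₃]
    rw [CupProduct.d_two_apply] at this
    exact this.symm
  · rintro ⟨ζ, hζ⟩
    refine ⟨fun y => ζ (y 0, y 1), funext fun x => ?_⟩
    rw [CupProduct.d_two_apply]
    exact (hζ (x 0) (x 1) (x 2)).symm

theorem IsAdapted.mem_cupKernel {π : cocycles₁ S.dualRep} {c : cocycles₂ (CStar G)}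
    (h : IsAdapted π c) : H1π S.dualRep π ∈ S.cupKernel :=
  (mem_cupKernel_iff S.surjInvRightHom π).2 ⟨_, h.isCupPrimitive _⟩

theorem exists_isAdapted {π : cocycles₁ S.dualRep} (h : H1π S.dualRep π ∈ S.cupKernel) :
    ∃ c, IsAdapted π c := by
  obtain ⟨ζ, hζ⟩ := (mem_cupKernel_iff S.surjInvRightHom π).1 h
  exact ⟨_, isAdapted_cocycleOfPrimitive hζ⟩

/-! ### Adapted classes under restriction and inflation -/

theorem IsAdapted.mem_ker_res {π : cocycles₁ S.dualRep} {c : cocycles₂ (CStar G)}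
    (h : IsAdapted π c) : H2π (CStar G) c ∈ S.res.ker := by
  rw [AddMonoidHom.mem_ker, res, pullbackH2_H2π, CStar_H2π_eq_zero_iff]
  -- Since `π(1) = 0`, the cocycle is constant on `A × A`, and a constant is the coboundary of the
  -- constant function with the same value.
  refine ⟨fun _ => evalCocycle₂ c 1 1, fun a b => ?_⟩
  have h1 := h.left a 1 (S.inl b)
  have h2 := h.right b 1 1
  rw [mul_one] at h1 h2
  rw [map_one S.rightHom, evalCocycle_one] at h2
  rw [pullbackCocycle_apply, h1, h2]
  abel

theorem evalCocycle_zero (g : Q) (a : A) : evalCocycle (S := S) 0 g a = 0 := rfl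

/-- With `π = 0` both variables ignore `A`, so the cocycle itself, not only its class, descends to
`Q`. -/
theorem IsAdapted.mem_range_inf {c : cocycles₂ (CStar G)} (h : IsAdapted (S := S) 0 c) :
    H2π (CStar G) c ∈ S.inf.range := by
  have hr (a x y) : evalCocycle₂ c x (S.inl a * y) = evalCocycle₂ c x y := by
    rw [h.right, evalCocycle_zero, sub_zero]
  let σ := S.surjInvRightHom
  let d : cocycles₂ (CStar Q) := mkCocycle₂ (fun g g' => evalCocycle₂ c (σ g) (σ g'))
    fun g₁ g₂ g₃ => by
      have h1 := cocycle_identity c (σ g₁) (σ g₂) (σ g₃)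
      rwa [← inl_factorSet, ← inl_factorSet, h.left, hr] at h1
  refine ⟨H2π _ d, ?_⟩
  rw [inf, pullbackH2_H2π]
  congr 1
  apply evalCocycle₂_ext
  intro x y
  rw [pullbackCocycle_apply]
  conv_rhs => rw [← inl_leftPart_mul σ x, ← inl_leftPart_mul σ y, h.left, hr]
  rfl

/-- Subtracting this coboundary from a cocycle adapted to a principal `π` leaves one adapted to `0`,
without changing the class. -/
theorem isAdapted_coboundary (χ : A →* ℂˣ) (σ : S.Section) (π : cocycles₁ S.dualRep)
    (hπ : ∀ g a, evalCocycle π g (S.quotAct g a) =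
      Additive.ofMul (χ a) - Additive.ofMul (χ (S.quotAct g a))) :
    IsAdapted π (coboundary fun x => - Additive.ofMul (χ (leftPart σ x))) where
  left a x y := by
    simp only [coboundary_apply, mul_assoc, leftPart_inl_mul, map_mul, ofMul_mul]
    abel
  right a x y := by
    simp only [coboundary_apply, leftPart_mul σ x, leftPart_inl_mul, rightHom_inl_mul,
      quotAct_map_mul, map_mul χ, ofMul_mul, hπ]
    abel

theorem IsAdapted.mem_range_inf_of_eq_zero {π : cocycles₁ S.dualRep} {c : cocycles₂ (CStar G)}
    (h : IsAdapted π c) (hπ : H1π S.dualRep π = 0) : H2π (CStar G) c ∈ S.inf.range := by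
  obtain ⟨χ, hχ⟩ := (H1π_dualRep_eq_zero_iff π).1 hπ
  have h1 := h.sub (isAdapted_coboundary χ S.surjInvRightHom π hχ)
  rw [sub_self] at h1
  have h2 := h1.mem_range_inf
  rwa [H2π_sub, H2π_coboundary, sub_zero] at h2

/-- Left invariance makes `f - f(1)` a character `χ` on `A`; the rule in the second variable then
gives `⟨π(g), g a⟩ = χ(g a) - χ(a)` additively. The sign is why the witness is `χ⁻¹`. -/
theorem IsAdapted.eq_zero_of_coboundary {π : cocycles₁ S.dualRep} {f : G → Additive ℂˣ}
    (h : IsAdapted π (coboundary f)) : H1π S.dualRep π = 0 := by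
  have hf (a : A) (y : G) : f (S.inl a * y) = f (S.inl a) + f y - f 1 := by
    have h1 := h.left a 1 y
    simp only [coboundary_apply, mul_one, one_mul] at h1
    rw [sub_self, zero_add, ← sub_eq_zero] at h1
    rw [← sub_eq_zero, ← neg_eq_zero, ← h1]
    abel
  let χ : A →* ℂˣ := AddMonoidHom.toMultiplicativeLeft
    { toFun a := f (S.inl (Additive.toMul a)) - f 1
      map_zero' := by simp
      map_add' a b := by simp [hf]; abel }
  have hχ (a : A) : Additive.ofMul (χ a) = f (S.inl a) - f 1 := rfl
  refine (H1π_dualRep_eq_zero_iff π).2 ⟨χ⁻¹, fun g a => ?_⟩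
  obtain ⟨x, rfl⟩ := S.rightHom_surjective g
  have h1 := h.right a x 1
  simp only [coboundary_apply, mul_one, mul_inl, hf] at h1
  rw [MonoidHom.inv_apply, MonoidHom.inv_apply, ofMul_inv, ofMul_inv, hχ, hχ]
  rw [← sub_eq_zero] at h1
  rw [← sub_eq_zero, ← h1]
  abel

theorem isAdapted_pullbackCocycle (d : cocycles₂ (CStar Q)) :
    IsAdapted (S := S) 0 (pullbackCocycle S.rightHom d) where
  left a x y := by simp only [pullbackCocycle_apply, rightHom_inl_mul]
  right a x y := by
    rw [pullbackCocycle_apply, pullbackCocycle_apply, rightHom_inl_mul, evalCocycle_zero, sub_zero]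

theorem IsAdapted.eq_zero_of_mem_range_inf {π : cocycles₁ S.dualRep} {c : cocycles₂ (CStar G)}
    (h : IsAdapted π c) (hc : H2π (CStar G) c ∈ S.inf.range) : H1π S.dualRep π = 0 := by
  obtain ⟨d, hd⟩ := hc
  induction d using H2_induction_on with
  | h d =>
    rw [inf, pullbackH2_H2π, eq_comm, ← sub_eq_zero, ← map_sub, CStar_H2π_eq_zero_iff] at hd
    obtain ⟨f, hf⟩ := hd
    have h1 := h.sub (isAdapted_pullbackCocycle d)
    have h2 : c - pullbackCocycle S.rightHom d = coboundary f :=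
      evalCocycle₂_ext fun x y => by rw [hf, coboundary_apply]
    rw [sub_zero, h2] at h1
    exact h1.eq_zero_of_coboundary

/-- Vanishing on `A × G` suffices: the cocycle identity with its first, second or third entry in `A`
yields, respectively, left invariance, the rule in the second variable, and the 1-cocycle law for
`π`. -/
theorem exists_isAdapted_of_forall_eq_zero {c : cocycles₂ (CStar G)}
    (hc : ∀ a y, evalCocycle₂ c (S.inl a) y = 0) : ∃ π : cocycles₁ S.dualRep, IsAdapted π c := by
  have hl (a : A) (x y : G) : evalCocycle₂ c (S.inl a * x) y = evalCocycle₂ c x y := by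
    have h := cocycle_identity c (S.inl a) x y
    rwa [hc, hc, add_zero, add_zero] at h
  have hr (a : A) (x y : G) :
      evalCocycle₂ c x (S.inl a * y) = evalCocycle₂ c x y + evalCocycle₂ c x (S.inl a) := by
    have h := cocycle_identity c x (S.inl a) y
    rw [mul_inl, hl, hc, zero_add] at h
    exact h.symm
  have hm (x y : G) (a : A) : evalCocycle₂ c (x * y) (S.inl a) =
      evalCocycle₂ c y (S.inl a) + evalCocycle₂ c x (S.inl (S.quotAct (S.rightHom y) a)) := by
    have h := cocycle_identity c x y (S.inl a)
    rw [mul_inl, hr, add_comm (evalCocycle₂ c x y), ← add_assoc] at h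
    exact add_right_cancel h
  have h1 (x : G) : evalCocycle₂ c x 1 = 0 := by simpa using hr 1 x 1
  let σ := S.surjInvRightHom
  -- By left invariance `c(x, a)` depends only on the image of `x` in `Q`, so `π` can be defined
  -- through lifts.
  have hσ (x : G) (a : A) :
      evalCocycle₂ c x (S.inl a) = evalCocycle₂ c (σ (S.rightHom x)) (S.inl a) := by
    conv_lhs => rw [← inl_leftPart_mul σ x, hl]
  let p (g : Q) : DualGroup A := DualGroup.mk (AddMonoidHom.toMultiplicativeLeft
    { toFun a := - evalCocycle₂ c (σ g) (S.inl (S.quotAct g⁻¹ (Additive.toMul a)))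
      map_zero' := by simp [h1]
      map_add' a b := by
        rw [toMul_add, quotAct_map_mul, map_mul S.inl, hr, neg_add_rev] })
  have hp (g : Q) (a : A) : Additive.ofMul ((p g).toHom a) =
    - evalCocycle₂ c (σ g) (S.inl (S.quotAct g⁻¹ a)) := rfl
  refine ⟨⟨p, (mem_cocycles₁_iff _).2 fun g h => DualGroup.ext fun a => ?_⟩, hl, fun a x y => ?_⟩
  · change Additive.ofMul ((p (g * h)).toHom a) = Additive.ofMul ((p h).toHom (S.quotAct g⁻¹ a)) +
      Additive.ofMul ((p g).toHom a)
    rw [hp, hp, hp, ← quotAct_mul, ← mul_inv_rev]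
    have := hm (σ g) (σ h) (S.quotAct (g * h)⁻¹ a)
    rw [hσ, map_mul S.rightHom, Section.rightHom_section, Section.rightHom_section,
      ← quotAct_mul, mul_inv_rev, mul_inv_cancel_left] at this
    rw [mul_inv_rev, this, neg_add]
  · change _ = _ - Additive.ofMul ((p (S.rightHom x)).toHom _)
    rw [hp, hr, quotAct_inv_quotAct, ← hσ, sub_neg_eq_add]

theorem exists_isAdapted_add_coboundary {c : cocycles₂ (CStar G)}
    (hc : H2π (CStar G) c ∈ S.res.ker) :
    ∃ (π : cocycles₁ S.dualRep) (f : G → Additive ℂˣ), IsAdapted π (c + coboundary f) := by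
  rw [AddMonoidHom.mem_ker, res, pullbackH2_H2π, CStar_H2π_eq_zero_iff] at hc
  obtain ⟨φ, hφ⟩ := hc
  let σ := S.surjInvRightHom
  -- This extends `-φ` from `A` to `G`, to kill `c` on `A × A`. The section need not send `1` to
  -- `1`, hence the division by the `A`-part of `1`.
  let f₁ (x : G) : Additive ℂˣ := - φ (leftPart σ x * (leftPart σ 1)⁻¹)
  have hf₁ (a : A) : f₁ (S.inl a) = - φ a := by
    have h := leftPart_inl_mul σ a 1
    rw [mul_one] at h
    simp only [f₁, h, mul_inv_cancel_right]
  set c₁ := c + coboundary f₁ with hc₁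
  have h₁ (a b : A) : evalCocycle₂ c₁ (S.inl a) (S.inl b) = 0 := by
    have h := hφ a b
    rw [pullbackCocycle_apply] at h
    rw [hc₁, evalCocycle₂_add, coboundary_apply, h, ← map_mul S.inl, hf₁, hf₁, hf₁]
    abel
  -- The cocycle identity for `a`, the `A`-part of `y` and the lift of its image gives `c₁(a, y) =
  -- f₂(a y) - f₂(y)`. As `σ 1` lies in `A`, `f₂` vanishes on `A`, so adding the coboundary of `f₂`
  -- kills `c₁` on `A × G`.
  let f₂ (x : G) : Additive ℂˣ := evalCocycle₂ c₁ (S.inl (leftPart σ x)) (σ (S.rightHom x))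
  obtain ⟨b, hb⟩ : ∃ b, S.inl b = σ 1 := by
    rw [← MonoidHom.mem_range, S.range_inl_eq_ker_rightHom, MonoidHom.mem_ker,
      Section.rightHom_section]
  obtain ⟨π, hπ⟩ := exists_isAdapted_of_forall_eq_zero (S := S) (c := c₁ + coboundary f₂) <| by
    intro a y
    have h := cocycle_identity c₁ (S.inl a) (S.inl (leftPart σ y)) (σ (S.rightHom y))
    rw [h₁, inl_leftPart_mul, add_zero, ← map_mul S.inl] at h
    simp only [evalCocycle₂_add, coboundary_apply, f₂, leftPart_inl_mul, rightHom_inl_mul,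
      rightHom_inl, ← hb, h₁, h]
    abel
  refine ⟨π, f₁ + f₂, ?_⟩
  convert hπ using 1
  apply evalCocycle₂_ext
  intro x y
  simp only [hc₁, evalCocycle₂_add, coboundary_apply, Pi.add_apply]
  abel

end GroupExtension

/-! ### Maps out of twisted group algebras and invariance under coboundaries -/

namespace TwistedGroupAlgebra

variable {G : Type} [Group G] {c : cocycles₂ (CStar G)}

theorem cocycleVal_eq (c : cocycles₂ (CStar G)) (x y : G) :
    cocycleVal c x y = ((Additive.toMul (evalCocycle₂ c x y) : ℂˣ) : ℂ) := rfl

/-- The algebra homomorphism out of a twisted group algebra determined by a projective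
representation. -/
def lift {B : Type*} [Ring B] [Algebra ℂ B] (u : G → B)
    (hu : ∀ x y, u x * u y = cocycleVal c x y • u (x * y)) (h1 : u 1 = cocycleVal c 1 1 • 1) :
    TwistedGroupAlgebra c →ₐ[ℂ] B :=
  AlgHom.ofLinearMap ((U c).constr ℂ u)
    (by
      rw [one_def, map_smul, Module.Basis.constr_basis, h1, smul_smul,
        inv_mul_cancel₀ (cocycleVal_ne_zero c 1 1), one_smul])
    (fun x y => by
      have h2 (g : G) : (U c).constr ℂ u (U c g * y) = u g * (U c).constr ℂ u y :=
        LinearMap.congr_fun (f := ((U c).constr ℂ u).comp (mulMap c (U c g)))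
          (g := (LinearMap.mulLeft ℂ (u g)).comp ((U c).constr ℂ u)) ((U c).ext fun h => by
            simp [mulMap_U, hu]) y
      exact LinearMap.congr_fun (f := ((U c).constr ℂ u).comp ((mulMap c).flip y))
          (g := (LinearMap.mulRight ℂ ((U c).constr ℂ u y)).comp ((U c).constr ℂ u))
          ((U c).ext fun g => by
            simp only [LinearMap.comp_apply, LinearMap.flip_apply, LinearMap.mulRight_apply,
              Module.Basis.constr_basis, ← mul_def, h2]) x)

theorem lift_U {B : Type*} [Ring B] [Algebra ℂ B] (u : G → B)
    (hu : ∀ x y, u x * u y = cocycleVal c x y • u (x * y)) (h1 : u 1 = cocycleVal c 1 1 • 1)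
    (g : G) : lift u hu h1 (U c g) = u g :=
  (U c).constr_basis ℂ u g

instance [Nonempty G] : Nontrivial (TwistedGroupAlgebra c) :=
  inferInstanceAs (Nontrivial (G →₀ ℂ))

instance [Finite G] : FiniteDimensional ℂ (TwistedGroupAlgebra c) :=
  Module.Basis.finiteDimensional_of_finite (U c)

theorem finrank_eq [Finite G] : Module.finrank ℂ (TwistedGroupAlgebra c) = Nat.card G :=
  Module.finrank_eq_nat_card_basis (U c)

/-- The twisted group algebras of cohomologous cocycles are isomorphic. -/
theorem nonempty_algEquiv_of_H2π_eq {d : cocycles₂ (CStar G)} [Finite G]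
    (h : H2π (CStar G) c = H2π (CStar G) d) :
    Nonempty (TwistedGroupAlgebra c ≃ₐ[ℂ] TwistedGroupAlgebra d) := by
  rw [← sub_eq_zero, ← H2π_sub, CStar_H2π_eq_zero_iff] at h
  obtain ⟨f, hf⟩ := h
  let w (x : G) : ℂˣ := Additive.toMul (f x)
  have hw (x y : G) :
      (w x : ℂ) * w y * cocycleVal d x y = cocycleVal c x y * w (x * y) := by
    have h1 : f x + f y + evalCocycle₂ d x y = evalCocycle₂ c x y + f (x * y) := by
      have h2 := hf x y
      rw [evalCocycle₂_sub, sub_eq_iff_eq_add] at h2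
      rw [h2]
      abel
    exact congrArg (fun z : Additive ℂˣ => ((Additive.toMul z : ℂˣ) : ℂ)) h1
  let φ : TwistedGroupAlgebra c →ₐ[ℂ] TwistedGroupAlgebra d :=
    lift (fun x => (w x : ℂ) • U d x)
      (fun x y => by
        rw [smul_mul_smul_comm, U_mul_U, smul_smul, smul_smul, hw])
      (by
        -- The unit condition is the relation `hw` at `(1, 1)`, with one factor `w 1` cancelled.
        have h1 := hw 1 1
        rw [mul_one, mul_assoc, mul_comm (cocycleVal c 1 1)] at h1
        have h2 := mul_left_cancel₀ (w 1).ne_zero h1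
        rw [one_def, smul_smul, ← h2, mul_assoc, mul_inv_cancel₀ (cocycleVal_ne_zero d 1 1),
          mul_one])
  have hs : Function.Surjective φ := by
    rw [← AlgHom.coe_toLinearMap, ← LinearMap.range_eq_top, ← top_le_iff, ← (U d).span_eq,
      Submodule.span_le]
    rintro _ ⟨x, rfl⟩
    refine ⟨((w x)⁻¹ : ℂˣ) • U c x, ?_⟩
    change φ (((w x)⁻¹ : ℂˣ) • U c x) = U d x
    rw [Units.smul_def, map_smul, lift_U, smul_smul, Units.inv_mul, one_smul]
  have hi : Function.Injective φ :=
    (LinearMap.injective_iff_surjective_of_finrank_eq_finrank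
      (f := φ.toLinearMap) (finrank_eq.trans finrank_eq.symm)).2 hs
  exact ⟨AlgEquiv.ofBijective φ ⟨hi, hs⟩⟩

end TwistedGroupAlgebra

theorem IsNondegenerate.of_H2π_eq {G : Type} [Group G] [Finite G] {c d : cocycles₂ (CStar G)}
    (hc : IsNondegenerate c) (h : H2π (CStar G) c = H2π (CStar G) d) : IsNondegenerate d := by
  obtain ⟨n, ⟨e⟩⟩ := hc
  obtain ⟨e'⟩ := TwistedGroupAlgebra.nonempty_algEquiv_of_H2π_eq h
  exact ⟨n, ⟨e'.symm.trans e⟩⟩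

/-! ### The induced projective representation and non-degeneracy -/

namespace GroupExtension

open TwistedGroupAlgebra

variable {A G Q : Type} [CommGroup A] [Group G] [Group Q] {S : GroupExtension A G Q}

theorem card_eq_mul (S : GroupExtension A G Q) : Nat.card G = Nat.card A * Nat.card Q := by
  rw [← Nat.card_prod]
  refine Nat.card_congr ⟨fun x => (leftPart S.surjInvRightHom x, S.rightHom x),
    fun p => S.inl p.1 * S.surjInvRightHom p.2, fun x => inl_leftPart_mul _ x, fun p => ?_⟩
  dsimp only
  rw [leftPart_inl_mul_section, rightHom_inl_mul, Section.rightHom_section]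

/-- The table of values of the characters `π(g)`. -/
def characterTable (π : cocycles₁ S.dualRep) : Matrix Q A ℂ :=
  fun g a => ((π g).toHom a : ℂˣ)

/-- Distinct characters are linearly independent, so the rows are independent and the rank is `|Q|`.
-/
theorem surjective_characterTable [Fintype A] [Fintype Q] {π : cocycles₁ S.dualRep}
    (hπ : Function.Injective (π : Q → S.dualRep.V)) :
    Function.Surjective (characterTable π).mulVecLin := by
  have hrow : LinearIndependent ℂ (characterTable π).row := by
    let χ (g : Q) : A →* ℂ := (Units.coeHom ℂ).comp (DualGroup.toHom (π g))
    have hinj : Function.Injective χ := fun g g' h =>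
      hπ (DualGroup.ext fun a => Units.ext (DFunLike.congr_fun h a))
    exact (linearIndependent_monoidHom A ℂ).comp χ hinj
  rw [← LinearMap.range_eq_top]
  apply Submodule.eq_top_of_finrank_eq
  rw [Module.finrank_fintype_fun_eq_card]
  exact hrow.rank_matrix

/-- Equal characters give equal rows, and then no vector in the image separates the two coordinates.
-/
theorem injective_of_surjective_characterTable [Fintype A] {π : cocycles₁ S.dualRep}
    (hs : Function.Surjective (characterTable π).mulVecLin) :
    Function.Injective (π : Q → S.dualRep.V) := by
  classical
  intro g g' h
  by_contra hne
  obtain ⟨t, ht⟩ := hs (Pi.single g 1)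
  have h1 : (characterTable π).mulVecLin t g = (characterTable π).mulVecLin t g' := by
    have h2 : characterTable π g = characterTable π g' :=
      funext fun a => congrArg (fun χ : DualGroup A => ((χ.toHom a : ℂˣ) : ℂ)) h
    simp only [Matrix.mulVecLin_apply, Matrix.mulVec, h2]
  rw [ht, Pi.single_eq_same, Pi.single_eq_of_ne (Ne.symm hne)] at h1
  exact one_ne_zero h1

variable [DecidableEq Q]

/-- The matrices of the projective representation of `G` induced from `A`. -/
def inducedMatrix (c : cocycles₂ (CStar G)) (σ : S.Section) (x : G) : Matrix Q Q ℂ :=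
  fun h h' => if h' = h * S.rightHom x then cocycleVal c (σ h) x else 0

/-- Each row has a single nonzero entry, so the product reduces to the cocycle identity at `(σ g, x,
y)`; left invariance replaces `σ g * x` by the chosen lift of its image. -/
theorem IsAdapted.inducedMatrix_mul {π : cocycles₁ S.dualRep} {c : cocycles₂ (CStar G)}
    [Fintype Q] (h : IsAdapted π c) (σ : S.Section) (x y : G) :
    inducedMatrix c σ x * inducedMatrix c σ y = cocycleVal c x y • inducedMatrix c σ (x * y) := by
  ext g g'
  rw [Matrix.mul_apply, Finset.sum_eq_single (g * S.rightHom x)]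
  · have h1 : σ g * x = S.inl (leftPart σ (σ g * x)) * σ (g * S.rightHom x) := by
      conv_lhs => rw [← inl_leftPart_mul σ (σ g * x), map_mul, Section.rightHom_section]
    have h2 := cocycleVal_mul c (σ g) x y
    rw [cocycleVal_eq c (σ g * x), h1, h.left, ← cocycleVal_eq, mul_comm] at h2
    simp only [inducedMatrix, Matrix.smul_apply, map_mul, mul_assoc, if_true, smul_eq_mul,
      mul_ite, mul_zero, h2]
  · intro g'' _ hg
    simp [inducedMatrix, hg]
  · simp

/-- The algebra homomorphism given by the projective representation of `G` induced from `A`. -/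
def IsAdapted.inducedHom {π : cocycles₁ S.dualRep} {c : cocycles₂ (CStar G)}
    [Fintype Q] (h : IsAdapted π c) (σ : S.Section) : TwistedGroupAlgebra c →ₐ[ℂ] Matrix Q Q ℂ :=
  lift (inducedMatrix c σ) (h.inducedMatrix_mul σ) (by
    ext g g'
    simp only [inducedMatrix, map_one, mul_one, cocycleVal_one_right, Matrix.smul_apply,
      Matrix.one_apply, eq_comm (a := g'), smul_eq_mul, mul_ite, mul_zero])

theorem IsAdapted.inducedMatrix_inl_mul {π : cocycles₁ S.dualRep} {c : cocycles₂ (CStar G)}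
    (h : IsAdapted π c) (σ : S.Section) (a : A) (x : G) (g g' : Q) :
    inducedMatrix c σ (S.inl a * x) g g' =
      characterTable π g⁻¹ a * inducedMatrix c σ x g g' := by
  have h1 : evalCocycle₂ c (σ g) (S.inl a * x) =
      evalCocycle π g⁻¹ a + evalCocycle₂ c (σ g) x := by
    rw [h.right, Section.rightHom_section, evalCocycle_inv, sub_eq_add_neg, add_comm]
  have h2 : cocycleVal c (σ g) (S.inl a * x) =
      characterTable π g⁻¹ a * cocycleVal c (σ g) x :=
    congrArg (fun z : Additive ℂˣ => ((Additive.toMul z : ℂˣ) : ℂ)) h1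
  simp only [inducedMatrix, rightHom_inl_mul, h2, mul_ite, mul_zero]

theorem IsAdapted.inducedHom_U {π : cocycles₁ S.dualRep} {c : cocycles₂ (CStar G)}
    [Fintype Q] (h : IsAdapted π c) (σ : S.Section) (x : G) :
    h.inducedHom σ (U c x) = inducedMatrix c σ x := lift_U _ _ _ x

/-- Combinations along the coset `A x` rescale the rows of one matrix by an arbitrary vector in the
image of the character table. This reduces the study of `inducedHom` to that table. -/
theorem IsAdapted.sum_inducedMatrix [Fintype A] {π : cocycles₁ S.dualRep}
    {c : cocycles₂ (CStar G)} (h : IsAdapted π c) (σ : S.Section) (t : A → ℂ) (x : G) (g g' : Q) :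
    (∑ a, t a • inducedMatrix c σ (S.inl a * x)) g g' =
      (characterTable π).mulVec t g⁻¹ * inducedMatrix c σ x g g' := by
  simp only [Matrix.sum_apply, Matrix.smul_apply, smul_eq_mul, h.inducedMatrix_inl_mul,
    Matrix.mulVec, dotProduct, Finset.sum_mul]
  exact Finset.sum_congr rfl fun a _ => by ring

variable [Fintype A] [Fintype Q]

/-- A vector killed by the table gives a combination of the `U_a`, `a ∈ A`, killed by the
representation. -/
theorem IsAdapted.injective_mulVecLin {π : cocycles₁ S.dualRep} {c : cocycles₂ (CStar G)}
    (h : IsAdapted π c) (σ : S.Section) (hinj : Function.Injective (h.inducedHom σ)) :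
    Function.Injective (characterTable π).mulVecLin := by
  rw [injective_iff_map_eq_zero]
  intro t ht
  have h1 : ∑ a, t a • U c (S.inl a) = 0 := by
    apply hinj
    rw [map_zero, map_sum]
    ext g g'
    have h2 := h.sum_inducedMatrix σ t 1 g g'
    rw [← Matrix.mulVecLin_apply, ht, Pi.zero_apply, zero_mul] at h2
    simpa only [map_smul, inducedHom_U, mul_one, Matrix.zero_apply] using h2
  exact funext (Fintype.linearIndependent_iff.1
    ((U c).linearIndependent.comp S.inl S.inl_injective) t h1)

theorem IsAdapted.surjective_inducedHom {π : cocycles₁ S.dualRep} {c : cocycles₂ (CStar G)}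
    (h : IsAdapted π c) (σ : S.Section)
    (hs : Function.Surjective (characterTable π).mulVecLin) :
    Function.Surjective (h.inducedHom σ) := by
  have hsingle (g g' : Q) (r : ℂ) : Matrix.single g g' r ∈ (h.inducedHom σ).range := by
    -- Row `g` of the matrix of this lift is supported in column `g'`; `t` is chosen to erase the
    -- other rows and normalize that entry.
    let x := σ (g⁻¹ * g')
    obtain ⟨t, ht⟩ := hs (Pi.single g⁻¹ (r * (cocycleVal c (σ g) x)⁻¹))
    refine ⟨∑ a, t a • U c (S.inl a * x), ?_⟩
    simp only [AlgHom.toRingHom_eq_coe, RingHom.coe_coe, map_sum, map_smul, inducedHom_U]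
    ext k k'
    rw [h.sum_inducedMatrix, ← Matrix.mulVecLin_apply, ht]
    simp only [inducedMatrix, x, Section.rightHom_section, Pi.single_apply, inv_inj,
      Matrix.single_apply]
    by_cases hk : k = g
    · subst hk
      rw [mul_inv_cancel_left, if_pos rfl]
      by_cases hk' : k' = g'
      · subst hk'
        rw [if_pos rfl, if_pos ⟨rfl, rfl⟩, inv_mul_cancel_right₀ (cocycleVal_ne_zero c _ _)]
      · rw [if_neg hk', if_neg (fun h => hk' h.2.symm), mul_zero]
    · rw [if_neg hk, zero_mul, if_neg (fun h => hk h.1.symm)]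
  intro m
  rw [← AlgHom.mem_range, Matrix.matrix_eq_sum_single m]
  exact sum_mem fun g _ => sum_mem fun g' _ => hsingle g g' _

theorem IsAdapted.isNondegenerate_iff_injective [Finite G] {π : cocycles₁ S.dualRep}
    {c : cocycles₂ (CStar G)} (h : IsAdapted π c) (hcard : Nat.card A = Nat.card Q) :
    IsNondegenerate c ↔ Function.Injective (π : Q → S.dualRep.V) := by
  let σ := S.surjInvRightHom
  have hcard' : Fintype.card A = Fintype.card Q := by
    rwa [Nat.card_eq_fintype_card, Nat.card_eq_fintype_card] at hcard
  constructor
  · rintro ⟨n, ⟨e⟩⟩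
    -- The case `n = 0` must be excluded: simplicity of the matrix algebra, which makes `inducedHom`
    -- injective, fails for the zero ring.
    have : Nonempty (Fin n) := by
      by_contra hn
      rw [not_nonempty_iff] at hn
      exact not_subsingleton _ e.toEquiv.subsingleton
    have hinj : Function.Injective (h.inducedHom σ) := by
      have h1 := RingHom.injective ((h.inducedHom σ).comp e.symm.toAlgHom).toRingHom
      intro x y hxy
      apply e.injective
      apply h1
      simpa using hxy
    apply injective_of_surjective_characterTable
    refine (LinearMap.injective_iff_surjective_of_finrank_eq_finrank ?_).1
      (h.injective_mulVecLin σ hinj)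
    rw [Module.finrank_fintype_fun_eq_card, Module.finrank_fintype_fun_eq_card, hcard']
  · intro hπ
    have hs := h.surjective_inducedHom σ (surjective_characterTable hπ)
    have hi : Function.Injective (h.inducedHom σ) :=
      (LinearMap.injective_iff_surjective_of_finrank_eq_finrank
        (f := (h.inducedHom σ).toLinearMap) (by
          rw [finrank_eq, card_eq_mul S, hcard, Module.finrank_matrix, Module.finrank_self,
            mul_one, Nat.card_eq_fintype_card])).2 hs
    exact ⟨Fintype.card Q, ⟨(AlgEquiv.ofBijective _ ⟨hi, hs⟩).trans
      (Matrix.reindexAlgEquiv ℂ ℂ (Fintype.equivFin Q))⟩⟩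

/-- An adapted cocycle is non-degenerate if and only if its 1-cocycle is bijective. -/
theorem IsAdapted.isNondegenerate_iff {A G Q : Type} [CommGroup A] [Group G] [Group Q] [Finite A]
    [Finite G] [Finite Q] {S : GroupExtension A G Q} {π : cocycles₁ S.dualRep}
    {c : cocycles₂ (CStar G)} (h : IsAdapted π c) (hcard : Nat.card A = Nat.card Q) :
    IsNondegenerate c ↔ Function.Bijective (π : Q → S.dualRep.V) := by
  classical
  have := Fintype.ofFinite A
  have := Fintype.ofFinite Q
  rw [h.isNondegenerate_iff_injective hcard]
  -- A finite abelian group and its complex dual have the same order, so an injective `π` is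
  -- bijective.
  have hd : Nat.card S.dualRep.V = Nat.card Q :=
    (CommGroup.card_monoidHom_of_hasEnoughRootsOfUnity A ℂ).trans hcard
  have : Finite S.dualRep.V := Nat.finite_of_card_ne_zero (hd ▸ Nat.card_pos.ne')
  exact ⟨fun hi => hi.bijective_of_nat_card_le hd.le, fun hb => hb.injective⟩

end GroupExtension

/-! ### The isomorphism modulo inflation -/

namespace GroupExtension

variable {A G Q : Type} [CommGroup A] [Group G] [Group Q] {S : GroupExtension A G Q}

/-- The class modulo inflation of a cocycle adapted to `π`. -/
def IsAdapted.quotientClass {π : cocycles₁ S.dualRep} {c : cocycles₂ (CStar G)}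
    (h : IsAdapted π c) : S.ResKerModInf :=
  QuotientAddGroup.mk ⟨H2π (CStar G) c, h.mem_ker_res⟩

theorem mk_eq_mk_iff {x y : H2 (CStar G)} (hx : x ∈ S.res.ker) (hy : y ∈ S.res.ker) :
    (QuotientAddGroup.mk ⟨x, hx⟩ : S.ResKerModInf) = QuotientAddGroup.mk ⟨y, hy⟩ ↔
      x - y ∈ S.inf.range := by
  rw [QuotientAddGroup.eq_iff_sub_mem, AddSubgroup.mem_addSubgroupOf]
  rfl

/-- The difference is adapted to `π - π'`, and an adapted class is inflated exactly when its
1-cocycle is principal. One direction makes `C` well defined, the other makes it injective. -/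
theorem IsAdapted.quotientClass_eq_iff {π π' : cocycles₁ S.dualRep} {c c' : cocycles₂ (CStar G)}
    (h : IsAdapted π c) (h' : IsAdapted π' c') :
    h.quotientClass = h'.quotientClass ↔ H1π S.dualRep π = H1π S.dualRep π' := by
  rw [quotientClass, quotientClass, mk_eq_mk_iff, ← H2π_sub,
    ← sub_eq_zero (a := H1π S.dualRep π)]
  have h1 : H1π S.dualRep (π - π') = H1π S.dualRep π - H1π S.dualRep π' :=
    map_sub (H1π S.dualRep).hom π π'
  rw [← h1]
  exact ⟨(h.sub h').eq_zero_of_mem_range_inf, (h.sub h').mem_range_inf_of_eq_zero⟩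

theorem IsAdapted.quotientClass_add {π π' : cocycles₁ S.dualRep} {c c' : cocycles₂ (CStar G)}
    (h : IsAdapted π c) (h' : IsAdapted π' c') :
    (h.add h').quotientClass = h.quotientClass + h'.quotientClass :=
  congrArg QuotientAddGroup.mk (Subtype.ext (H2π_add c c'))

theorem exists_isAdapted_of_class (x : S.cupKernel) :
    ∃ (π : cocycles₁ S.dualRep) (c : cocycles₂ (CStar G)),
      H1π S.dualRep π = x ∧ IsAdapted π c := by
  obtain ⟨x, hx⟩ := x
  induction x using H1_induction_on with
  | h π =>
    obtain ⟨c, hc⟩ := exists_isAdapted hx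
    exact ⟨π, c, rfl, hc⟩

theorem exists_isAdapted_of_mem_ker_res {x : H2 (CStar G)} (hx : x ∈ S.res.ker) :
    ∃ (π : cocycles₁ S.dualRep) (c : cocycles₂ (CStar G)),
      H2π (CStar G) c = x ∧ IsAdapted π c := by
  induction x using H2_induction_on with
  | h c =>
    obtain ⟨π, f, h⟩ := exists_isAdapted_add_coboundary hx
    exact ⟨π, _, by rw [H2π_add, H2π_coboundary, add_zero], h⟩

/-- The formula covers all adapted pairs, so `C` is independent of the choices of representatives
and can be evaluated with any section and any `ζ`. -/
theorem exists_addEquiv (S : GroupExtension A G Q) :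
    ∃ C : S.cupKernel ≃+ S.ResKerModInf, ∀ (π : cocycles₁ S.dualRep) (c : cocycles₂ (CStar G))
      (h : IsAdapted π c), C ⟨H1π S.dualRep π, h.mem_cupKernel⟩ = h.quotientClass := by
  choose p c hp hc using exists_isAdapted_of_class (S := S)
  have hC (x : S.cupKernel) {π : cocycles₁ S.dualRep} {d : cocycles₂ (CStar G)}
      (h : IsAdapted π d) (hx : H1π S.dualRep π = x) : (hc x).quotientClass = h.quotientClass :=
    ((hc x).quotientClass_eq_iff h).2 ((hp x).trans hx.symm)
  let F : S.cupKernel →+ S.ResKerModInf := AddMonoidHom.mk' (fun x => (hc x).quotientClass)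
    fun x y => by
      rw [← IsAdapted.quotientClass_add]
      refine hC _ _ ?_
      refine (map_add (H1π S.dualRep).hom (p x) (p y)).trans ?_
      exact congrArg₂ (· + ·) (hp x) (hp y)
  refine ⟨AddEquiv.ofBijective F ⟨fun x y hxy => ?_, fun y => ?_⟩, fun π d h => hC _ h rfl⟩
  · have h := ((hc x).quotientClass_eq_iff (hc y)).1 hxy
    rw [hp, hp] at h
    exact Subtype.ext h
  · obtain ⟨⟨y, hy⟩, rfl⟩ := QuotientAddGroup.mk_surjective y
    obtain ⟨π, d, rfl, h⟩ := exists_isAdapted_of_mem_ker_res hy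
    exact ⟨⟨H1π S.dualRep π, h.mem_cupKernel⟩, hC _ h rfl⟩

end GroupExtension

end

open GroupExtension in
theorem theoremA {A G Q : Type} [CommGroup A] [Group G] [Group Q] [Finite A] [Finite G] [Finite Q]
    (S : GroupExtension A G Q) (hcard : Nat.card A = Nat.card Q) :
    ∃ C : S.cupKernel ≃+ S.ResKerModInf,
      (∀ (σ : S.Section) (π : groupCohomology.cocycles₁ S.dualRep)
          (ζ : Q × Q → Additive ℂˣ),
        (∀ g₁ g₂ g₃ : Q, groupCohomology.d₂₃ (CStar Q) ζ (g₁, g₂, g₃) =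
          Additive.ofMul ((π g₁).toHom (S.quotAct g₁ (S.factorSet σ g₂ g₃)))) →
        ∃ (hπ : groupCohomology.H1π S.dualRep π ∈ S.cupKernel)
          (c : groupCohomology.cocycles₂ (CStar G))
          (hc : groupCohomology.H2π (CStar G) c ∈ S.res.ker),
          (∀ (a₁ a₂ : A) (g₁ g₂ : Q),
            c (S.inl a₁ * σ g₁, S.inl a₂ * σ g₂) =
              ζ (g₁, g₂) - Additive.ofMul ((π g₁).toHom (S.quotAct g₁ a₂))) ∧
          C ⟨groupCohomology.H1π S.dualRep π, hπ⟩ =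
            QuotientAddGroup.mk ⟨groupCohomology.H2π (CStar G) c, hc⟩) ∧
      Set.BijOn C S.bijectiveClasses S.nondegenerateClasses := by
  obtain ⟨C, hC⟩ := exists_addEquiv S
  refine ⟨C, fun σ π ζ hζ => ?_, ?_, C.injective.injOn, ?_⟩
  · have hζ' : IsCupPrimitive σ π ζ := hζ
    have h := isAdapted_cocycleOfPrimitive hζ'
    refine ⟨h.mem_cupKernel, _, h.mem_ker_res, fun a₁ a₂ g₁ g₂ => ?_, hC π _ h⟩
    refine (cocycleOfPrimitive_apply hζ' _ _).trans ?_
    rw [rightHom_inl_mul, rightHom_inl_mul, Section.rightHom_section, Section.rightHom_section,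
      leftPart_inl_mul_section]
    rfl
  · rintro ⟨x, hx⟩ ⟨π, rfl, hπ⟩
    obtain ⟨c, h⟩ := exists_isAdapted hx
    exact ⟨⟨_, h.mem_ker_res⟩, ⟨c, rfl, (h.isNondegenerate_iff hcard).2 hπ⟩, (hC π c h).symm⟩
  · rintro _ ⟨⟨x, hx⟩, ⟨d, hd, hn⟩, rfl⟩
    -- The given non-degenerate representative `d` need not be adapted; non-degeneracy passes to the
    -- cohomologous adapted `c`, which forces `π` to be bijective.
    obtain ⟨π, c, rfl, h⟩ := exists_isAdapted_of_mem_ker_res hx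
    exact ⟨⟨_, h.mem_cupKernel⟩, ⟨π, rfl, (h.isNondegenerate_iff hcard).1 (hn.of_H2π_eq hd)⟩,
      hC π c h⟩
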